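/- Let $I$ be a non-empty (possibly uncountable) set. For each $i\in I$ let $X_i$ be a non-empty compact convex subset of a real Hausdorff locally convex topological vector space $E_i$, let $X=\prod_{i\in I}X_i$ with the product topology, and let $A_i,B_i,P_i:X\to 2^{X_i}$ be correspondences (set-valued maps, possibly with empty values). Write $(\mathrm{cl}\,B_i)(x)$ for the closure of $B_i(x)$ in $X_i$, and let $\overline{B}_i:X\to 2^{X_i}$ be the correspondence whose graph is the closure in $X\times X_i$ of the graph of $B_i$. Definitions. Let $C$ be a convex subset of a real vector space and $Y$ a subset of a real vector space, and let $\Delta_{n-1}\subset\mathbb{R}^n$ be the standard simplex. A correspondence $T:C\to 2^{Y}$ is weakly naturally quasi-concave if for each $n$ and each finite set $\{x_1,\dots,x_n\}\subset C$ there exist $y_k\in T(x_k)$ and continuous functions $g_k:[0,1]\to[0,1]$ with $g_k(0)=0$, $g_k(1)=1$ $(k=1,\dots,n)$ such that for every $(\lambda_1,\dots,\lambda_n)\in\Delta_{n-1}$ we have $(g_1(\lambda_1),\dots,g_n(\lambda_n))\in\Delta_{n-1}$ and $\sum_k g_k(\lambda_k)y_k\in T\bigl(\sum_k\lambda_kx_k\bigr)$.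 A correspondence $S:X\to2^{X_i}$ has the e-WNQS-property on $K\subset X$ if for every convex neighborhood $V$ of $0$ in $E_i$ there is a weakly naturally quasi-concave correspondence $T^{V}:K\to 2^{X_i}$ such that $x_i\notin T^V(x)$ and $T^V(x)\subset S(x)+V$ for all $x\in K$. Theorem 15. Assume that for each $i\in I$: (1) $\mathrm{cl}\,B_i$ is upper semicontinuous with non-empty convex values; (2) the set $W_i:=\{x\in X: A_i(x)\cap P_i(x)\neq\emptyset\}$ is open in $X$, and there is a (finite-dimensional) simplex $K_i\subset X$, i.e. the convex hull of finitely many, and at least one, affinely independent points of $\prod_{j\in I}E_j$, such that $W_i\subset \mathrm{int}_X(K_i)$; (3) $\mathrm{cl}\,B_i$ has the e-WNQS-property on $K_i$. Then there exists an equilibrium point $\overline{x}\in X$, i.e. a point such that for each $i\in I$, $\overline{x}_i\in\overline{B}_i(\overline{x})$ and $A_i(\overline{x})\cap P_i(\overline{x})=\emptyset$. -/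

import Mathlib

open scoped Topology

/-- A correspondence `T : C → 2^Y`, where `C` and `Y` are subsets of vector spaces, is *weakly
naturally quasi-concave* if for every finite set `{x₁, …, xₙ} ⊆ C` there are `yₖ ∈ T(xₖ)` and
continuous `gₖ : [0,1] → [0,1]` with `gₖ(0) = 0`, `gₖ(1) = 1`, such that
`l ↦ (g₁(l₁), …, gₙ(lₙ))` maps the standard simplex to itself and
`∑ gₖ(lₖ) yₖ ∈ T(∑ lₖ xₖ)` for every `l` in the standard simplex. -/
def WeaklyNaturallyQuasiConcave {E F : Type*} [AddCommGroup E] [Module ℝ E]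
    [AddCommGroup F] [Module ℝ F] {C : Set E} {Y : Set F} (T : C → Set Y) : Prop :=
  ∀ (n : ℕ) (x : Fin n → C), Function.Injective x →
    ∃ y : Fin n → Y, (∀ k, y k ∈ T (x k)) ∧
      ∃ g : Fin n → ℝ → ℝ,
        (∀ k, ContinuousOn (g k) (Set.Icc 0 1) ∧ g k 0 = 0 ∧ g k 1 = 1) ∧
        ∀ l ∈ stdSimplex ℝ (Fin n),
          (fun k => g k (l k)) ∈ stdSimplex ℝ (Fin n) ∧
          ∃ (z : C) (w : Y), (z : E) = ∑ k, l k • (x k : E) ∧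
            (w : F) = ∑ k, g k (l k) • (y k : F) ∧ w ∈ T z

/-- `K` is an `m`-dimensional simplex: the convex hull of `m + 1` affinely independent points. -/
def IsSimplex {E : Type*} [AddCommGroup E] [Module ℝ E] (m : ℕ) (K : Set E) : Prop :=
  ∃ s : Affine.Simplex ℝ E m, K = convexHull ℝ (Set.range s.points)

/-- The correspondence whose graph is the closure of the graph of `T`. -/
def graphAdherence {X Y : Type*} [TopologicalSpace X] [TopologicalSpace Y] (T : X → Set Y) :
    X → Set Y :=
  fun x => {y | (x, y) ∈ closure {p : X × Y | p.2 ∈ T p.1}}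

/-- An abstract economy `(Xᵢ, Aᵢ, Pᵢ, Bᵢ)` with set of agents `I`: agent `i` has the set of actions
`Xᵢ ⊆ Eᵢ`, the constraint correspondences `Aᵢ, Bᵢ : X → 2^{Xᵢ}` and the preference correspondence
`Pᵢ : X → 2^{Xᵢ}`, where `X = ∏ Xᵢ`. -/
structure AbstractEconomy (I : Type*) (E : I → Type*) where
  /-- The action sets. -/
  X : ∀ i, Set (E i)
  /-- The first constraint correspondences. -/
  A : ∀ i, Set.univ.pi X → Set (X i)
  /-- The preference correspondences. -/
  P : ∀ i, Set.univ.pi X → Set (X i)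
  /-- The second constraint correspondences. -/
  B : ∀ i, Set.univ.pi X → Set (X i)

namespace AbstractEconomy

variable {I : Type*} {E : I → Type*}

/-- The `i`-th coordinate `xᵢ ∈ Xᵢ` of a point `x ∈ X`. -/
def coord (G : AbstractEconomy I E) (i : I) (x : Set.univ.pi G.X) : G.X i :=
  ⟨x.1 i, x.2 i (Set.mem_univ i)⟩

/-- The domain `Wᵢ = {x ∈ X | (Aᵢ ∩ Pᵢ)(x) ≠ ∅}`. -/
def W (G : AbstractEconomy I E) (i : I) : Set (Set.univ.pi G.X) :=
  {x | (G.A i x ∩ G.P i x).Nonempty}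

/-- The correspondence `cl Bᵢ`; the closures are taken in `Xᵢ`. -/
def clB [∀ i, TopologicalSpace (E i)] (G : AbstractEconomy I E) (i : I) :
    Set.univ.pi G.X → Set (G.X i) :=
  fun x => closure (G.B i x)

/-- The correspondence `S : X → 2^{Xᵢ}` has the *e-WNQS-property* on `K ⊆ X`: for every convex
neighborhood `V` of `0` in `Eᵢ` there is a weakly naturally quasi-concave correspondence
`T : K → 2^{Xᵢ}` with `xᵢ ∉ T(x)` and `T(x) ⊆ S(x) + V` for all `x ∈ K`. -/
def EWNQS [∀ i, AddCommGroup (E i)] [∀ i, Module ℝ (E i)] [∀ i, TopologicalSpace (E i)]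
    (G : AbstractEconomy I E) (i : I) (S : Set.univ.pi G.X → Set (G.X i))
    (K : Set (∀ j, E j)) (hK : K ⊆ Set.univ.pi G.X) : Prop :=
  ∀ V : Set (E i), Convex ℝ V → V ∈ 𝓝 (0 : E i) →
    ∃ T : K → Set (G.X i), WeaklyNaturallyQuasiConcave T ∧
      ∀ x : K,
        G.coord i ⟨x.1, hK x.2⟩ ∉ T x ∧
        ∀ y ∈ T x, ∃ b ∈ S ⟨x.1, hK x.2⟩, ∃ v ∈ V, (y : E i) = (b : E i) + v

/-- `x ∈ X` is an *equilibrium* if, for each `i`, `xᵢ ∈ B̄ᵢ(x)` and `Aᵢ(x) ∩ Pᵢ(x) = ∅`, where the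
graph of `B̄ᵢ` is the closure of the graph of `Bᵢ` in `X × Xᵢ`. -/
def IsEquilibrium [∀ i, TopologicalSpace (E i)] (G : AbstractEconomy I E)
    (x : Set.univ.pi G.X) : Prop :=
  ∀ i, G.coord i x ∈ graphAdherence (G.B i) x ∧ G.A i x ∩ G.P i x = ∅

end AbstractEconomy

/-!
For each agent `i` fix a closed convex neighbourhood `V i` of `0`. On the simplex `K i` the weakly
naturally quasi-concave correspondence `T` given by the e-WNQS-property has a continuous selection,
namely `∑ lₖ xₖ ↦ ∑ gₖ(lₖ) yₖ` over the vertices `xₖ`. The correspondence that is this selection on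
`W i` and `(cl Bᵢ + V i) ∩ Xᵢ` off `W i` has a closed graph and nonempty convex values, because the
selection takes values in `cl Bᵢ + V i` and `W i` is open
(`AbstractEconomy.exists_isClosed_graph`). The product of these correspondences has a fixed point
`x` by the Kakutani–Fan–Glicksberg theorem (`exists_diag_mem_of_isClosed_graph`). As `xᵢ ∉ T x` on
`K i`, the point `x` lies outside every `W i`, so that `xᵢ ∈ cl Bᵢ(x) + V i`. The sets of such
points are compact and directed in `V`; a common point is an equilibrium.

The Kakutani–Fan–Glicksberg theorem is reduced to Brouwer's theorem on the standard simplex by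
partitions of unity. Brouwer's theorem (`exists_fixedPoint_stdSimplex`) is derived from Scarf's
lemma (`exists_isPrimitiveSet_image_eq_univ`), a parity argument that needs no triangulation:
colour the points `x` of a fine net by a coordinate `i` with `x i ≤ f x i`; a primitive set with all
colours then consists of points that are close to each other and yields a point which `f` hardly
decreases in any coordinate.
-/

/-! ### Scarf's lemma -/

section Scarf

variable {α ι R : Type*} [Fintype ι] [LinearOrder R]

/-- A *primitive set* (or *room*) for the rankings `r i`, `i : ι`: a set of `card ι` elements such
that no element of `α` lies, in every ranking, strictly above the least element of the set. -/
def IsPrimitiveSet (r : ι → α → R) (S : Finset α) : Prop :=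
  S.card = Fintype.card ι ∧ ∀ y, ∃ i, ∀ s ∈ S, r i y ≤ r i s

variable {r : ι → α → R}

/-- In a primitive set, each element is the least one in exactly one ranking. -/
theorem IsPrimitiveSet.existsUnique_isLeast {S : Finset α} (hS : IsPrimitiveSet r S)
    (hr : ∀ i, Function.Injective (r i)) {s : α} (hs : s ∈ S) :
    ∃! i, ∀ s' ∈ S, r i s ≤ r i s' := by
  classical
  have hne : S.Nonempty := ⟨s, hs⟩
  choose m hmS hm using fun i => S.exists_min_image (r i) hne
  -- `m i` is the least element in the ranking `i`; it maps `ι` onto `S`, hence bijectively.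
  have hsurj : Function.Surjective (fun i => (⟨m i, hmS i⟩ : S)) := by
    rintro ⟨x, hx⟩
    obtain ⟨i, hi⟩ := hS.2 x
    exact ⟨i, Subtype.ext (hr i ((hm i x hx).antisymm (hi _ (hmS i))))⟩
  have hcard : Fintype.card ι = Fintype.card S := by rw [Fintype.card_coe, hS.1]
  have hbij := (Fintype.bijective_iff_surjective_and_card _).2 ⟨hsurj, hcard⟩
  have key : ∀ i, (∀ s' ∈ S, r i s ≤ r i s') ↔ m i = s := fun i =>
    ⟨fun h => hr i ((hm i s hs).antisymm (h _ (hmS i))), fun h => h ▸ hm i⟩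
  obtain ⟨i, hi⟩ := hsurj ⟨s, hs⟩
  refine ⟨i, (key i).2 (congrArg Subtype.val hi), fun j hj => hbij.1 ?_⟩
  rw [hi]
  exact Subtype.ext ((key j).1 hj)

/-- If `insert t D` is primitive with least element `t` in the ranking `k`, then `t` is determined
by `D` and `k`. -/
theorem IsPrimitiveSet.eq_of_isLeast [DecidableEq α] {D : Finset α} {t t' : α}
    {k : ι} (hr : ∀ i, Function.Injective (r i)) (ht : IsPrimitiveSet r (insert t D))
    (ht' : IsPrimitiveSet r (insert t' D))
    (hk : ∀ s ∈ D, r k t ≤ r k s) (hk' : ∀ s ∈ D, r k t' ≤ r k s) : t = t' := by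
  wlog hlt : r k t ≤ r k t' generalizing t t'
  · exact (this ht' ht hk' hk (le_of_not_ge hlt)).symm
  obtain ⟨i, hi⟩ := ht.2 t'
  have hii : ∀ s ∈ insert t' D, r i t' ≤ r i s := by
    intro s hs
    rcases Finset.mem_insert.1 hs with rfl | hs
    · exact le_rfl
    · exact hi s (Finset.mem_insert_of_mem hs)
  have hkk : ∀ s ∈ insert t' D, r k t' ≤ r k s := by
    intro s hs
    rcases Finset.mem_insert.1 hs with rfl | hs
    · exact le_rfl
    · exact hk' s hs
  obtain rfl := (ht'.existsUnique_isLeast hr (Finset.mem_insert_self _ _)).unique hii hkk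
  exact hr i (hlt.antisymm (hi t (Finset.mem_insert_self _ _)))

/-- Pivoting step: if `insert t D` is primitive and `t` is its least element in the ranking `k`,
then the least element of `D` in the ranking `k` is also the least element of `D` in one further
ranking `j`. The elements that complete `D` to a primitive set are `t` and one further element,
which is least in the ranking `j`; `hext` provides candidates for it, high enough in all rankings
but `j`. -/
theorem IsPrimitiveSet.exists_pair [DecidableEq α] [Fintype α] {D : Finset α} {t : α}
    (htD : t ∉ D) (hD : D.Nonempty) (hr : ∀ i, Function.Injective (r i))
    (ht : IsPrimitiveSet r (insert t D))
    (hext : ∀ j k d, j ≠ k → d ∈ D → (∀ s ∈ D, r j d ≤ r j s) → (∀ s ∈ D, r k d ≤ r k s) →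
      ∃ y ∉ D, ∀ l, l ≠ j → ∃ s ∈ D, r l s < r l y) :
    ∃ t' ∉ D, t' ≠ t ∧ IsPrimitiveSet r (insert t' D) ∧
      ∀ u ∉ D, IsPrimitiveSet r (insert u D) → u = t ∨ u = t' := by
  classical
  obtain ⟨k, hk, -⟩ := ht.existsUnique_isLeast hr (Finset.mem_insert_self t D)
  have hkD : ∀ s ∈ D, r k t ≤ r k s := fun s hs => hk s (Finset.mem_insert_of_mem hs)
  obtain ⟨d, hdD, hd⟩ := D.exists_min_image (r k) hD
  obtain ⟨j, hj, -⟩ := ht.existsUnique_isLeast hr (Finset.mem_insert_of_mem hdD)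
  have hjD : ∀ s ∈ D, r j d ≤ r j s := fun s hs => hj s (Finset.mem_insert_of_mem hs)
  have hjk : j ≠ k := by
    rintro rfl
    have : d = t := hr j ((hj t (Finset.mem_insert_self _ _)).antisymm (hkD d hdD))
    exact htD (this ▸ hdD)
  -- The second completion is the highest, in the ranking `j`, of the elements that exceed the
  -- least element of `D` in all the other rankings.
  obtain ⟨y, hyD, hy⟩ := hext j k d hjk hdD hjD hd
  obtain ⟨t', ht'A, ht'max⟩ := (Finset.univ.filter fun x => x ∉ D ∧
    ∀ l, l ≠ j → ∃ s ∈ D, r l s < r l x).exists_max_image (r j)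
    ⟨y, Finset.mem_filter.2 ⟨Finset.mem_univ _, hyD, hy⟩⟩
  obtain ⟨ht'D, ht'l⟩ := (Finset.mem_filter.1 ht'A).2
  have hnot : ∀ x, ¬ ∀ l, ∃ s ∈ D, r l s < r l x := by
    intro x hx
    obtain ⟨i, hi⟩ := ht.2 x
    obtain ⟨s, hs, hlt⟩ := hx i
    exact absurd (hi s (Finset.mem_insert_of_mem hs)) (not_le.2 hlt)
  have ht'j : ∀ s ∈ D, r j t' ≤ r j s := by
    by_contra! hcon
    exact hnot t' fun l => if h : l = j then h ▸ hcon else ht'l l h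
  have hroom : IsPrimitiveSet r (insert t' D) := by
    refine ⟨by rw [Finset.card_insert_of_notMem ht'D, ← Finset.card_insert_of_notMem htD, ht.1],
      fun x => ?_⟩
    by_contra! hcon
    have hx : ∀ l, l ≠ j → ∃ s ∈ D, r l s < r l x := by
      intro l hl
      obtain ⟨s, hs, hlt⟩ := hcon l
      rcases Finset.mem_insert.1 hs with rfl | hs
      · obtain ⟨s', hs', hlt'⟩ := ht'l l hl
        exact ⟨s', hs', hlt'.trans hlt⟩
      · exact ⟨s, hs, hlt⟩
    have hxD : x ∉ D := by
      intro hxD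
      obtain ⟨i, hi, hiu⟩ := ht.existsUnique_isLeast hr (Finset.mem_insert_of_mem hxD)
      have hij : i = j := by
        by_contra h
        obtain ⟨s, hs, hlt⟩ := hx i h
        exact absurd (hi s (Finset.mem_insert_of_mem hs)) (not_le.2 hlt)
      subst hij
      have hxd : x = d := hr i ((hi d (Finset.mem_insert_of_mem hdD)).antisymm (hjD x hxD))
      obtain ⟨s, hs, hlt⟩ := hx k hjk.symm
      exact absurd (hd s hs) (not_le.2 (hxd ▸ hlt))
    have hxt' := ht'max x (Finset.mem_filter.2 ⟨Finset.mem_univ _, hxD, hx⟩)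
    obtain ⟨s, hs, hlt⟩ := hcon j
    rcases Finset.mem_insert.1 hs with rfl | hs
    · exact absurd hxt' (not_le.2 hlt)
    · exact hnot x fun l => if h : l = j then h ▸ ⟨s, hs, hlt⟩ else hx l h
  refine ⟨t', ht'D, ?_, hroom, fun u huD hu => ?_⟩
  · rintro rfl
    obtain ⟨s, hs, hlt⟩ := ht'l k hjk.symm
    exact absurd (hkD s hs) (not_le.2 hlt)
  · obtain ⟨i, hi, -⟩ := hu.existsUnique_isLeast hr (Finset.mem_insert_self u D)
    have hiD : ∀ s ∈ D, r i u ≤ r i s := fun s hs => hi s (Finset.mem_insert_of_mem hs)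
    -- Otherwise `d` would be the least element of `insert u D` in both rankings `j` and `k`.
    have hi' : i = k ∨ i = j := by
      by_contra! hcon
      obtain ⟨l, hl, hlu⟩ := hu.existsUnique_isLeast hr (Finset.mem_insert_of_mem hdD)
      obtain ⟨a, ha, hau⟩ := hu.existsUnique_isLeast hr (Finset.mem_insert_self u D)
      have hlow : ∀ b, b ≠ i → (∀ s ∈ D, r b d ≤ r b s) → b = l := by
        intro b hb hbD
        refine hlu b fun s hs => ?_
        rcases Finset.mem_insert.1 hs with rfl | hs
        · by_contra! hlt
          refine hb ((hau b ?_).trans (hau i hi).symm)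
          intro s' hs'
          rcases Finset.mem_insert.1 hs' with rfl | hs'
          · exact le_rfl
          · exact hlt.le.trans (hbD s' hs')
        · exact hbD s hs
      exact hjk ((hlow j hcon.2.symm hjD).trans (hlow k hcon.1.symm hd).symm)
    rcases hi' with rfl | rfl
    · exact Or.inl (hu.eq_of_isLeast hr ht hiD hkD)
    · exact Or.inr (hu.eq_of_isLeast hr hroom hiD ht'j)

/-- **Scarf's lemma**. The elements `e i` (*slack* elements) are the least ones in the ranking `i`
and lie above all non-slack elements in the other rankings. If `c` colours `e i` with the colour
`i`, then some primitive set carries all the colours. -/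
theorem exists_isPrimitiveSet_image_eq_univ [Fintype α] [Nonempty ι] [DecidableEq ι]
    (hr : ∀ i, Function.Injective (r i)) (e : ι → α) (hmin : ∀ i x, r i (e i) ≤ r i x)
    (hmax : ∀ i j, j ≠ i → ∀ x ∉ Set.range e, r i x < r i (e j))
    (c : α → ι) (hc : ∀ i, c (e i) = i) :
    ∃ S : Finset α, IsPrimitiveSet r S ∧ S.image c = Finset.univ := by
  classical
  by_contra! hno
  obtain ⟨i₀⟩ := ‹Nonempty ι›
  have he : Function.Injective e := fun i j h => by rw [← hc i, h, hc]
  -- `Q` is the set of pairs of a door `D`, carrying all colours but `i₀`, and an element completing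
  -- it to a room. Counted by rooms its size is even, counted by doors it is odd.
  let Q : Finset (Finset α × α) := Finset.univ.filter fun p =>
    p.2 ∉ p.1 ∧ p.1.image c = Finset.univ.erase i₀ ∧ IsPrimitiveSet r (insert p.2 p.1)
  have memQ : ∀ p, p ∈ Q ↔ p.2 ∉ p.1 ∧ p.1.image c = Finset.univ.erase i₀ ∧
      IsPrimitiveSet r (insert p.2 p.1) := fun p => by simp [Q]
  have card_door : ∀ p ∈ Q, p.1.card = (Finset.univ.erase i₀).card := by
    intro p hp
    obtain ⟨h1, -, h3⟩ := (memQ p).1 hp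
    have := h3.1
    rw [Finset.card_insert_of_notMem h1] at this
    rw [Finset.card_erase_of_mem (Finset.mem_univ _), Finset.card_univ]
    omega
  have c_inj : ∀ p ∈ Q, Set.InjOn c p.1 := by
    intro p hp
    refine Finset.card_image_iff.1 ?_
    rw [((memQ p).1 hp).2.1, card_door p hp]
  have heven : Even Q.card := by
    rw [Finset.card_eq_sum_card_fiberwise (f := fun p => insert p.2 p.1) (t := Finset.univ)
      (fun _ _ => Finset.mem_coe.2 (Finset.mem_univ _))]
    refine Finset.even_sum _ fun S _ => ?_
    rcases Finset.eq_empty_or_nonempty (Q.filter fun p => insert p.2 p.1 = S) with h0 | ⟨p, hp⟩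
    · simp [h0]
    obtain ⟨hpQ, rfl⟩ := Finset.mem_filter.1 hp
    obtain ⟨D, t⟩ := p
    obtain ⟨htD, hcD, hroom⟩ := (memQ _).1 hpQ
    have hinj := c_inj _ hpQ
    simp only at htD hcD hroom hinj
    have hct : c t ∈ D.image c := by
      by_contra h
      refine hno _ hroom ?_
      have : c t = i₀ := by simpa [hcD] using h
      rw [Finset.image_insert, hcD, this, Finset.insert_erase (Finset.mem_univ _)]
    obtain ⟨t', ht'D, hct'⟩ := Finset.mem_image.1 hct
    have hne : t' ≠ t := fun h => htD (h ▸ ht'D)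
    have hfib : (Q.filter fun p => insert p.2 p.1 = insert t D) =
        {(D, t), ((insert t D).erase t', t')} := by
      ext ⟨D', u⟩
      simp only [Finset.mem_filter, memQ, Finset.mem_insert, Finset.mem_singleton, Prod.mk.injEq]
      constructor
      · rintro ⟨⟨huD', hcD', -⟩, hins⟩
        have hD' : D' = (insert t D).erase u := by
          rw [← hins, Finset.erase_insert huD']
        have hu : u ∈ insert t D := hins ▸ Finset.mem_insert_self _ _
        rcases Finset.mem_insert.1 hu with rfl | huD
        · exact Or.inl ⟨by rw [hD', Finset.erase_insert htD], rfl⟩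
        · right
          have : c u ∈ D'.image c := by rw [hcD', ← hcD]; exact Finset.mem_image_of_mem _ huD
          obtain ⟨v, hv, hcv⟩ := Finset.mem_image.1 this
          rw [hD', Finset.mem_erase, Finset.mem_insert] at hv
          obtain ⟨hvu, rfl | hvD⟩ := hv
          · have : u = t' := hinj huD ht'D (by rw [← hcv, hct'])
            subst this
            exact ⟨hD', rfl⟩
          · exact absurd (hinj hvD huD hcv) hvu
      · rintro (⟨rfl, rfl⟩ | ⟨rfl, rfl⟩)
        · exact ⟨⟨htD, hcD, hroom⟩, rfl⟩
        · have hins : insert u ((insert t D).erase u) = insert t D :=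
            Finset.insert_erase (Finset.mem_insert_of_mem ht'D)
          refine ⟨⟨Finset.notMem_erase _ _, ?_, hins.symm ▸ hroom⟩, hins⟩
          rw [← hcD]
          ext i
          simp only [Finset.mem_image, Finset.mem_erase, Finset.mem_insert]
          constructor
          · rintro ⟨v, ⟨hvu, rfl | hv⟩, rfl⟩
            · exact ⟨u, ht'D, hct'⟩
            · exact ⟨v, hv, rfl⟩
          · rintro ⟨v, hv, rfl⟩
            by_cases hvu : v = u
            · exact ⟨t, ⟨hne.symm, Or.inl rfl⟩, by rw [hvu, hct']⟩
            · exact ⟨v, ⟨hvu, Or.inr hv⟩, rfl⟩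
    rw [hfib, Finset.card_pair (by simp [hne.symm])]
    exact even_two
  -- The only door completed by an odd number of elements consists of slack elements.
  let D₀ : Finset α := (Finset.univ.erase i₀).image e
  have hodd : Odd (Q.filter fun p => p.1 = D₀).card := by
    have hcD₀ : D₀.image c = Finset.univ.erase i₀ := by
      rw [Finset.image_image, show c ∘ e = id from funext hc, Finset.image_id]
    have hcard₀ : D₀.card + 1 = Fintype.card ι := by
      rw [Finset.card_image_of_injective _ he, Finset.card_erase_of_mem (Finset.mem_univ _),
        Finset.card_univ]
      have := Fintype.card_pos_iff.2 ⟨i₀⟩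
      omega
    have hmem₀ : ∀ l, l ≠ i₀ → e l ∈ D₀ := fun l hl =>
      Finset.mem_image_of_mem _ (Finset.mem_erase.2 ⟨hl, Finset.mem_univ _⟩)
    have hi₀ : e i₀ ∉ D₀ := by simp [D₀, he.eq_iff]
    obtain ⟨t, htm, ht⟩ := (Finset.univ \ D₀).exists_max_image (r i₀) ⟨e i₀, by simp [hi₀]⟩
    have htD : t ∉ D₀ := (Finset.mem_sdiff.1 htm).2
    have hlow : ∀ y ∉ D₀, ∀ s ∈ D₀, r i₀ y ≤ r i₀ s := by
      intro y hy s hs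
      obtain ⟨l, hl, rfl⟩ := Finset.mem_image.1 hs
      by_cases hye : y ∈ Set.range e
      · obtain ⟨m, rfl⟩ := hye
        have : m = i₀ := by
          by_contra h
          exact hy (hmem₀ m h)
        exact this ▸ hmin _ _
      · exact (hmax _ _ (Finset.ne_of_mem_erase hl) y hye).le
    have hfib : (Q.filter fun p => p.1 = D₀) = {(D₀, t)} := by
      ext ⟨D, u⟩
      simp only [Finset.mem_filter, memQ, Finset.mem_singleton, Prod.mk.injEq]
      constructor
      · rintro ⟨⟨huD, -, hroom⟩, rfl⟩
        refine ⟨rfl, ?_⟩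
        obtain ⟨i, hi⟩ := hroom.2 t
        have hii : i = i₀ := by
          by_contra h
          have := hi (e i) (Finset.mem_insert_of_mem (hmem₀ i h))
          exact htD (hr i (this.antisymm (hmin _ _)) ▸ hmem₀ i h)
        subst hii
        exact hr i ((ht u (by simp [huD])).antisymm (hi u (Finset.mem_insert_self _ _)))
      · rintro ⟨rfl, rfl⟩
        refine ⟨⟨htD, hcD₀, by rw [Finset.card_insert_of_notMem htD, hcard₀], fun y => ?_⟩, rfl⟩
        by_cases hy : y ∈ D₀
        · obtain ⟨l, -, rfl⟩ := Finset.mem_image.1 hy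
          exact ⟨l, fun s _ => hmin _ _⟩
        · refine ⟨i₀, fun s hs => ?_⟩
          rcases Finset.mem_insert.1 hs with rfl | hs
          · exact ht y (by simp [hy])
          · exact hlow y hy s hs
    rw [hfib, Finset.card_singleton]
    exact odd_one
  have hrest : ∀ D ≠ D₀, Even (Q.filter fun p => p.1 = D).card := by
    intro D hDne
    rcases Finset.eq_empty_or_nonempty (Q.filter fun p => p.1 = D) with h0 | ⟨p, hp⟩
    · simp [h0]
    obtain ⟨hpQ, rfl⟩ := Finset.mem_filter.1 hp
    obtain ⟨D, t⟩ := p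
    have hcardD := card_door _ hpQ
    obtain ⟨htD, hcD, hroom⟩ := (memQ _).1 hpQ
    simp only at htD hcD hroom hDne hcardD ⊢
    obtain ⟨s, hsD, hs⟩ : ∃ s ∈ D, s ∉ Set.range e := by
      by_contra! hcon
      refine hDne (Finset.eq_of_subset_of_card_le (fun x hx => ?_) ?_)
      · obtain ⟨l, rfl⟩ := hcon x hx
        refine Finset.mem_image_of_mem _ ?_
        rw [← hcD]
        exact Finset.mem_image.2 ⟨e l, hx, hc l⟩
      · rw [hcardD]
        exact Finset.card_image_le
    obtain ⟨t', ht'D, hne, hroom', huniq⟩ := hroom.exists_pair htD ⟨s, hsD⟩ hr (by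
      intro j k d hjk hd hdj hdk
      refine ⟨e j, fun hej => ?_, fun l hl => ⟨s, hsD, hmax l j hl.symm s hs⟩⟩
      have : d = e j := hr j ((hdj _ hej).antisymm (hmin _ _))
      exact absurd (hdk s hsD) (not_le.2 (this ▸ hmax k j hjk s hs)))
    have hfib : (Q.filter fun p => p.1 = D) = {(D, t), (D, t')} := by
      ext ⟨D', u⟩
      simp only [Finset.mem_filter, memQ, Finset.mem_insert, Finset.mem_singleton, Prod.mk.injEq]
      constructor
      · rintro ⟨⟨hu, -, hur⟩, rfl⟩
        rcases huniq u hu hur with h | h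
        · exact Or.inl ⟨rfl, h⟩
        · exact Or.inr ⟨rfl, h⟩
      · rintro (⟨rfl, rfl⟩ | ⟨rfl, rfl⟩)
        · exact ⟨⟨htD, hcD, hroom⟩, rfl⟩
        · exact ⟨⟨ht'D, hcD, hroom'⟩, rfl⟩
    rw [hfib, Finset.card_pair (by simp [hne.symm])]
    exact even_two
  rw [Finset.card_eq_sum_card_fiberwise (f := fun p => p.1) (t := Finset.univ)
      (fun _ _ => Finset.mem_coe.2 (Finset.mem_univ _)),
    ← Finset.add_sum_erase _ _ (Finset.mem_univ D₀)] at heven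
  have : Odd _ := hodd.add_even (Finset.even_sum (s := Finset.univ.erase D₀) _
    fun D hD => hrest D (Finset.ne_of_mem_erase hD))
  exact (Nat.not_even_iff_odd.2 this) heven

end Scarf

/-! ### Brouwer's fixed point theorem on the standard simplex -/

section Brouwer

variable {ι : Type*} [Fintype ι]

/-- Scarf's lemma for a finite set of points of `ℝ^ι`, ranked by their coordinates (with ties broken
arbitrarily) and coloured by `c`: the non-slack part `σ` of a primitive set with all colours, and
the set `C` of the indices whose slack element is not used. -/
theorem exists_finset_colored [Nonempty ι] (T : Finset (ι → ℝ)) (hT : T.Nonempty)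
    (hT01 : ∀ x ∈ T, ∀ i, x i ∈ Set.Icc (0 : ℝ) 1) (c : (ι → ℝ) → ι) :
    ∃ σ ⊆ T, ∃ C : Finset ι, C.Nonempty ∧ (∀ i ∈ C, ∃ x ∈ σ, c x = i) ∧
      ∀ y ∈ T, ∃ i ∈ C, ∀ x ∈ σ, y i ≤ x i := by
  classical
  let α := T ⊕ ι
  let idx : α ≃ Fin (Fintype.card α) := Fintype.equivFin α
  -- All coordinates of points of `T` lie in `[0, 1]`, between the values at the slack elements.
  let u : ι → α → ℝ := fun i => Sum.elim (fun x => x.1 i) fun j => if j = i then -1 else 2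
  let r : ι → α → ℝ ×ₗ Fin (Fintype.card α) := fun i a => toLex (u i a, idx a)
  have hle : ∀ i a b, r i a ≤ r i b → u i a ≤ u i b := fun i a b h => by
    rcases Prod.Lex.toLex_le_toLex.1 h with h | h
    · exact h.le
    · exact h.1.le
  have hlt : ∀ i a b, u i a < u i b → r i a < r i b := fun i a b h =>
    Prod.Lex.toLex_lt_toLex.2 (Or.inl h)
  have hr : ∀ i, Function.Injective (r i) := fun i a b h =>
    idx.injective (congrArg (fun p => (ofLex p).2) h)
  have hmin : ∀ i x, r i (Sum.inr i) ≤ r i x := by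
    rintro i (x | j)
    · refine (hlt _ _ _ ?_).le
      have := (hT01 x.1 x.2 i).1
      simp only [u, Sum.elim_inl, Sum.elim_inr, if_true]
      linarith
    · by_cases h : j = i
      · rw [h]
      · refine (hlt _ _ _ ?_).le
        simp only [u, Sum.elim_inr, if_true, if_neg h]
        norm_num
  have hmax : ∀ i j, j ≠ i → ∀ x ∉ Set.range (Sum.inr : ι → α), r i x < r i (Sum.inr j) := by
    rintro i j hji (x | l) hx
    · refine hlt _ _ _ ?_
      have := (hT01 x.1 x.2 i).2
      simp only [u, Sum.elim_inl, Sum.elim_inr, if_neg hji]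
      linarith
    · exact absurd ⟨l, rfl⟩ hx
  obtain ⟨S, hS, hcS⟩ := exists_isPrimitiveSet_image_eq_univ hr Sum.inr hmin hmax
    (Sum.elim (fun x : T => c x.1) id) fun i => rfl
  have hdom : ∀ y ∈ T, ∃ i, Sum.inr i ∉ S ∧ ∀ x : T, Sum.inl x ∈ S → y i ≤ x.1 i := by
    intro y hy
    obtain ⟨i, hi⟩ := hS.2 (Sum.inl ⟨y, hy⟩)
    refine ⟨i, fun hiS => ?_, fun x hx => hle _ _ _ (hi _ hx)⟩
    have h1 := hle _ _ _ (hi _ hiS)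
    have h2 := (hT01 y hy i).1
    simp only [u, Sum.elim_inl, Sum.elim_inr, if_true] at h1
    linarith
  refine ⟨T.filter fun x => ∃ h : x ∈ T, Sum.inl ⟨x, h⟩ ∈ S, Finset.filter_subset _ _,
    Finset.univ.filter fun i => Sum.inr i ∉ S, ?_, ?_, ?_⟩
  · obtain ⟨y, hy⟩ := hT
    obtain ⟨i, hi, -⟩ := hdom y hy
    exact ⟨i, by simpa using hi⟩
  · intro i hi
    have hi' : Sum.inr i ∉ S := by simpa using hi
    obtain ⟨s, hs, hsi⟩ := Finset.mem_image.1 (hcS ▸ Finset.mem_univ i)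
    rcases s with x | j
    · exact ⟨x.1, Finset.mem_filter.2 ⟨x.2, x.2, hs⟩, hsi⟩
    · have : j = i := hsi
      exact absurd (this ▸ hs) hi'
  · intro y hy
    obtain ⟨i, hi, h⟩ := hdom y hy
    refine ⟨i, by simpa using hi, fun x hx => ?_⟩
    obtain ⟨-, hxT, hxS⟩ := Finset.mem_filter.1 hx
    exact h ⟨x, hxT⟩ hxS

/-- If every point of an `η`-net of the simplex is at most, in some coordinate from `C`, the points
of `σ`, then the points of `σ` almost agree in the coordinates from `C` and almost vanish in the
other ones: the coordinatewise minimum over `σ` has almost full mass on `C`. -/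
theorem forall_abs_sub_le_of_net {η : ℝ} {T σ : Finset (ι → ℝ)} {C : Finset ι}
    (hT : ∀ z ∈ stdSimplex ℝ ι, ∃ y ∈ T, dist z y < η) (hσ : ∀ x ∈ σ, x ∈ stdSimplex ℝ ι)
    (hσne : σ.Nonempty) (hC : C.Nonempty) (hdom : ∀ y ∈ T, ∃ i ∈ C, ∀ x ∈ σ, y i ≤ x i) :
    ∀ x ∈ σ, (∀ i ∉ C, x i ≤ Fintype.card ι * η) ∧
      ∀ x' ∈ σ, ∀ i ∈ C, |x i - x' i| ≤ Fintype.card ι * η := by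
  classical
  choose a haσ ha using fun i : ι => σ.exists_min_image (fun x => x i) hσne
  let m : ι → ℝ := fun i => a i i
  have hm0 : ∀ i, 0 ≤ m i := fun i => (hσ _ (haσ i)).1 i
  have hmle : ∀ x ∈ σ, ∀ i, m i ≤ x i := fun x hx i => ha i x hx
  have hsumC : ∀ x ∈ σ, ∑ i ∈ C, x i ≤ 1 := fun x hx => by
    rw [← (hσ x hx).2]
    exact Finset.sum_le_univ_sum_of_nonneg (hσ x hx).1
  have hμ1 : ∑ i ∈ C, m i ≤ 1 := by
    obtain ⟨x, hx⟩ := hσne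
    exact (Finset.sum_le_sum fun i _ => hmle x hx i).trans (hsumC x hx)
  have hCpos : (0 : ℝ) < C.card := by exact_mod_cast hC.card_pos
  -- Spread the missing mass evenly over `C`; a net point near the result forces it to be small.
  let γ : ℝ := (1 - ∑ i ∈ C, m i) / C.card
  have hγC : C.card * γ = 1 - ∑ i ∈ C, m i := by
    simp only [γ]; field_simp
  have hγ0 : 0 ≤ γ := div_nonneg (by linarith) hCpos.le
  let z : ι → ℝ := fun i => if i ∈ C then m i + γ else 0
  have hz : z ∈ stdSimplex ℝ ι := by
    refine ⟨fun i => ?_, ?_⟩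
    · simp only [z]
      split_ifs
      · exact add_nonneg (hm0 i) hγ0
      · exact le_rfl
    · simp only [z]
      rw [Finset.sum_ite_mem, Finset.univ_inter, Finset.sum_add_distrib, Finset.sum_const,
        nsmul_eq_mul, hγC]
      ring
  obtain ⟨y, hyT, hy⟩ := hT z hz
  obtain ⟨i, hiC, hi⟩ := hdom y hyT
  have hγη : γ < η := by
    have h1 : dist (z i) (y i) < η := (dist_le_pi_dist z y i).trans_lt hy
    have h2 : y i ≤ m i := hi (a i) (haσ i)
    rw [Real.dist_eq] at h1
    have h3 := (abs_lt.1 h1).2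
    simp only [z, if_pos hiC] at h3
    linarith
  have hmass : 1 - ∑ i ∈ C, m i ≤ Fintype.card ι * η := by
    rw [← hγC]
    have : (C.card : ℝ) ≤ Fintype.card ι := by exact_mod_cast Finset.card_le_univ C
    exact mul_le_mul this hγη.le hγ0 (Nat.cast_nonneg _)
  have hclose : ∀ x ∈ σ, ∀ i ∈ C, x i - m i ≤ Fintype.card ι * η := by
    intro x hx i hi
    refine le_trans ?_ hmass
    have h1 : x i - m i ≤ ∑ j ∈ C, (x j - m j) :=
      Finset.single_le_sum (f := fun j => x j - m j)
        (fun j _ => sub_nonneg.2 (hmle x hx j)) hi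
    rw [Finset.sum_sub_distrib] at h1
    linarith [hsumC x hx]
  intro x hx
  refine ⟨fun i hi => le_trans ?_ hmass, fun x' hx' i hi => ?_⟩
  · have h1 : x i ≤ ∑ j ∈ Cᶜ, x j :=
      Finset.single_le_sum (f := fun j => x j) (fun j _ => (hσ x hx).1 j) (by simpa using hi)
    have h2 : ∑ j ∈ C, x j + ∑ j ∈ Cᶜ, x j = 1 := by
      rw [Finset.sum_add_sum_compl]; exact (hσ x hx).2
    have h3 : ∑ j ∈ C, m j ≤ ∑ j ∈ C, x j := Finset.sum_le_sum fun j _ => hmle x hx j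
    linarith
  · rw [abs_le]
    constructor <;> linarith [hclose x hx i hi, hclose x' hx' i hi, hmle x hx i, hmle x' hx' i]

/-- A continuous self-map of the standard simplex moves some point down by at most `ε` in every
coordinate. -/
theorem exists_forall_sub_le [Nonempty ι] {f : (ι → ℝ) → ι → ℝ}
    (hf : ContinuousOn f (stdSimplex ℝ ι)) (hmaps : Set.MapsTo f (stdSimplex ℝ ι) (stdSimplex ℝ ι))
    {ε : ℝ} (hε : 0 < ε) : ∃ x ∈ stdSimplex ℝ ι, ∀ i, x i - f x i ≤ ε := by
  classical
  have huc := (isCompact_stdSimplex (𝕜 := ℝ) ι).uniformContinuousOn_of_continuous hf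
  obtain ⟨δ, hδ, hδf⟩ := Metric.uniformContinuousOn_iff.1 huc (ε / 2) (half_pos hε)
  have hn : (0 : ℝ) < Fintype.card ι := by exact_mod_cast Fintype.card_pos
  let κ := min (δ / 2) (ε / 2)
  have hκ : 0 < κ := lt_min (half_pos hδ) (half_pos hε)
  have hκη : Fintype.card ι * (κ / Fintype.card ι) = κ := by field_simp
  obtain ⟨T, hTs, hT⟩ := (isCompact_stdSimplex (𝕜 := ℝ) ι).elim_nhds_subcover
    (fun x => Metric.ball x (κ / Fintype.card ι)) fun x _ => Metric.ball_mem_nhds x (div_pos hκ hn)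
  have hnet : ∀ z ∈ stdSimplex ℝ ι, ∃ y ∈ T, dist z y < κ / Fintype.card ι := fun z hz => by
    simpa using hT hz
  obtain ⟨i₀⟩ := ‹Nonempty ι›
  have hTne : T.Nonempty := by
    obtain ⟨y, hy, -⟩ := hnet _ (single_mem_stdSimplex ℝ i₀)
    exact ⟨y, hy⟩
  -- A point is coloured by a coordinate that `f` does not decrease.
  have hcol : ∀ x : ι → ℝ, ∃ i, x ∈ stdSimplex ℝ ι → x i ≤ f x i := by
    intro x
    by_cases hx : x ∈ stdSimplex ℝ ι
    · obtain ⟨i, -, hi⟩ := Finset.exists_le_of_sum_le (s := Finset.univ) (f := x) (g := f x)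
        ⟨i₀, Finset.mem_univ _⟩ (by rw [hx.2, (hmaps hx).2])
      exact ⟨i, fun _ => hi⟩
    · exact ⟨i₀, fun h => absurd h hx⟩
  choose c hc using hcol
  have : Nonempty ι := ⟨i₀⟩
  obtain ⟨σ, hσT, C, hC, hCσ, hdom⟩ := exists_finset_colored T hTne
    (fun x hx i => mem_Icc_of_mem_stdSimplex (hTs x hx) i) c
  have hσ : ∀ x ∈ σ, x ∈ stdSimplex ℝ ι := fun x hx => hTs x (hσT hx)
  obtain ⟨x, hxσ⟩ : σ.Nonempty := by
    obtain ⟨i, hi⟩ := hC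
    obtain ⟨x, hx, -⟩ := hCσ i hi
    exact ⟨x, hx⟩
  have hnear := forall_abs_sub_le_of_net hnet hσ ⟨x, hxσ⟩ hC hdom
  simp only [hκη] at hnear
  have hκδ : κ < δ := (min_le_left _ _).trans_lt (half_lt_self hδ)
  have hκε : κ ≤ ε / 2 := min_le_right _ _
  refine ⟨x, hσ x hxσ, fun i => ?_⟩
  by_cases hi : i ∈ C
  · obtain ⟨x', hx', hcx'⟩ := hCσ i hi
    have hdist : dist x x' < δ := by
      refine lt_of_le_of_lt ((dist_pi_le_iff hκ.le).2 fun j => ?_) hκδ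
      rw [Real.dist_eq]
      by_cases hj : j ∈ C
      · exact (hnear x hxσ).2 x' hx' j hj
      · rw [abs_le]
        constructor <;> linarith [(hnear x hxσ).1 j hj, (hnear x' hx').1 j hj,
          (hσ x hxσ).1 j, (hσ x' hx').1 j]
    have h1 : |f x i - f x' i| < ε / 2 := by
      rw [← Real.dist_eq]
      exact (dist_le_pi_dist _ _ i).trans_lt (hδf x (hσ x hxσ) x' (hσ x' hx') hdist)
    have h2 := (hnear x hxσ).2 x' hx' i hi
    have h3 : x' i ≤ f x' i := hcx' ▸ hc x' (hσ x' hx')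
    linarith [(abs_lt.1 h1).1, (abs_le.1 h2).2]
  · linarith [(hnear x hxσ).1 i hi, (hmaps (hσ x hxσ)).1 i]

/-- **Brouwer's fixed point theorem** for the standard simplex. -/
theorem exists_fixedPoint_stdSimplex [Nonempty ι] {f : (ι → ℝ) → ι → ℝ}
    (hf : ContinuousOn f (stdSimplex ℝ ι))
    (hmaps : Set.MapsTo f (stdSimplex ℝ ι) (stdSimplex ℝ ι)) :
    ∃ x ∈ stdSimplex ℝ ι, f x = x := by
  classical
  let g : (ι → ℝ) → ℝ := fun x => ∑ i, max 0 (x i - f x i)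
  have hg : ContinuousOn g (stdSimplex ℝ ι) := by
    refine continuousOn_finsetSum _ fun i _ =>
      (continuous_const.max continuous_id).comp_continuousOn ?_
    exact (continuous_apply i).continuousOn.sub ((continuous_apply i).comp_continuousOn hf)
  obtain ⟨i₀⟩ := ‹Nonempty ι›
  obtain ⟨x, hx, hmin⟩ := (isCompact_stdSimplex (𝕜 := ℝ) ι).exists_isMinOn
    ⟨_, single_mem_stdSimplex ℝ i₀⟩ hg
  have hgx : g x ≤ 0 := by
    refine le_of_forall_pos_le_add fun ε hε => ?_
    have : Nonempty ι := ⟨i₀⟩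
    have hn : (0 : ℝ) < Fintype.card ι := by exact_mod_cast Fintype.card_pos
    obtain ⟨y, hy, hyε⟩ := exists_forall_sub_le hf hmaps (div_pos hε hn)
    have h1 : g y ≤ ∑ _i : ι, ε / Fintype.card ι :=
      Finset.sum_le_sum fun i _ => max_le (div_pos hε hn).le (hyε i)
    rw [Finset.sum_const, Finset.card_univ, nsmul_eq_mul, mul_div_cancel₀ _ hn.ne'] at h1
    have h2 : g x ≤ g y := hmin hy
    linarith
  have hle : ∀ i, x i ≤ f x i := by
    intro i
    have h1 : max 0 (x i - f x i) ≤ g x :=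
      Finset.single_le_sum (f := fun i => max 0 (x i - f x i)) (fun j _ => le_max_left _ _)
        (Finset.mem_univ i)
    linarith [le_max_right 0 (x i - f x i)]
  refine ⟨x, hx, funext fun i => ((Finset.sum_eq_sum_iff_of_le fun i _ => hle i).1 ?_ i
    (Finset.mem_univ i)).symm⟩
  rw [hx.2, (hmaps hx).2]

end Brouwer

/-! ### The Kakutani–Fan–Glicksberg fixed point theorem -/

section KakutaniFanGlicksberg

variable {E : Type*} [AddCommGroup E] [Module ℝ E] [TopologicalSpace E]

/-- For a nonempty-valued correspondence with graph `Γ` on a compact convex set, and a neighbourhood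
`U` of `0`, some point `x` is a convex combination of values at points `a` with `x - a ∈ U`: a fixed
point of the map that mixes finitely many values by a partition of unity. -/
theorem exists_mem_convexHull_of_mem_nhds [IsTopologicalAddGroup E] [ContinuousSMul ℝ E] [T2Space E]
    {X : Set E} (hXne : X.Nonempty) (hXc : IsCompact X) (hXconv : Convex ℝ X) {Γ : Set (E × E)}
    (hsub : Γ ⊆ X ×ˢ X) (hne : ∀ x ∈ X, ∃ y, (x, y) ∈ Γ) {U : Set E} (hU : U ∈ 𝓝 0) :
    ∃ x ∈ X, x ∈ convexHull ℝ {y | ∃ a ∈ X, x - a ∈ U ∧ (a, y) ∈ Γ} := by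
  classical
  have : CompactSpace X := isCompact_iff_compactSpace.1 hXc
  let O : X → Set X := fun a => (fun x : X => (x : E) - a) ⁻¹' interior U
  have hOopen : ∀ a, IsOpen (O a) := fun a => isOpen_interior.preimage (by fun_prop)
  have hOmem : ∀ a, a ∈ O a := fun a => by
    simpa [O] using mem_interior_iff_mem_nhds.2 hU
  obtain ⟨t, -, ht⟩ := isCompact_univ.elim_nhds_subcover O fun a _ => (hOopen a).mem_nhds (hOmem a)
  obtain ⟨ρ, hρ⟩ := PartitionOfUnity.exists_isSubordinate (s := Set.univ) isClosed_univ
    (fun a : t => O a) (fun a => hOopen a) (by simpa [Set.iUnion_subtype] using ht)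
  choose y hy using fun a : t => hne a.1 a.1.2
  have hyX : ∀ a, y a ∈ X := fun a => (hsub (hy a)).2
  have hsum : ∀ x, ∑ a, ρ a x = 1 := fun x => by
    rw [← finsum_eq_sum_of_fintype]; exact ρ.sum_eq_one (Set.mem_univ x)
  have hcomb : ∀ l ∈ stdSimplex ℝ t, ∑ a, l a • y a ∈ X := fun l hl =>
    hXconv.sum_mem (fun a _ => hl.1 a) hl.2 fun a _ => hyX a
  obtain ⟨x₀, hx₀⟩ := hXne
  have htne : Nonempty t := by
    obtain ⟨a, ha⟩ := Set.mem_iUnion.1 (ht (Set.mem_univ (⟨x₀, hx₀⟩ : X)))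
    exact ⟨⟨a, (Set.mem_iUnion.1 ha).1⟩⟩
  let f : (t → ℝ) → t → ℝ := fun l =>
    if h : ∑ a, l a • y a ∈ X then fun a => ρ a ⟨_, h⟩ else 0
  have hfeq : ∀ l (h : ∑ a, l a • y a ∈ X) a, f l a = ρ a ⟨_, h⟩ := fun l h a => by
    simp only [f, dif_pos h]
  have hfcont : ContinuousOn f (stdSimplex ℝ t) := by
    rw [continuousOn_iff_continuous_domRestrict]
    refine continuous_pi fun a => ?_
    have hcont : Continuous fun l : stdSimplex ℝ t => ρ a ⟨_, hcomb l.1 l.2⟩ :=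
      (ρ a).continuous.comp (Continuous.subtype_mk (continuous_finsetSum _ fun b _ =>
        ((continuous_apply b).comp continuous_subtype_val).smul continuous_const) _)
    exact hcont.congr fun l => (hfeq l.1 (hcomb l.1 l.2) a).symm
  have hfmaps : Set.MapsTo f (stdSimplex ℝ t) (stdSimplex ℝ t) := by
    intro l hl
    refine ⟨fun a => ?_, ?_⟩
    · rw [hfeq l (hcomb l hl)]; exact ρ.nonneg _ _
    · simp only [hfeq l (hcomb l hl)]; exact hsum _
  obtain ⟨l, hl, hfl⟩ := exists_fixedPoint_stdSimplex hfcont hfmaps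
  refine ⟨_, hcomb l hl, ?_⟩
  rw [← Finset.sum_filter_of_ne (p := fun a => l a ≠ 0) fun a _ h h0 => h (by rw [h0, zero_smul])]
  refine (convex_convexHull ℝ _).sum_mem (fun a _ => hl.1 a) ?_ fun a ha => subset_convexHull ℝ _ ?_
  · rw [Finset.sum_filter_ne_zero, hl.2]
  · -- A vertex of positive weight is `U`-close to the point because of the support of `ρ a`.
    have hla : ρ a ⟨_, hcomb l hl⟩ ≠ 0 := by
      rw [← hfeq l (hcomb l hl), hfl]; exact (Finset.mem_filter.1 ha).2
    have hO := hρ a (subset_tsupport _ hla)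
    refine ⟨a.1, a.1.2, ?_, hy a⟩
    rw [Finset.sum_filter_of_ne (p := fun a => l a ≠ 0)
      fun a _ h h0 => h (by rw [h0, zero_smul])]
    exact interior_subset hO

/-- The **Kakutani–Fan–Glicksberg fixed point theorem**, for a correspondence given by its graph
`Γ`. -/
theorem exists_diag_mem_of_isClosed_graph [IsTopologicalAddGroup E] [ContinuousSMul ℝ E]
    [LocallyConvexSpace ℝ E] [T2Space E]
    {X : Set E} (hXne : X.Nonempty) (hXc : IsCompact X) (hXconv : Convex ℝ X) {Γ : Set (E × E)}
    (hΓ : IsClosed Γ) (hsub : Γ ⊆ X ×ˢ X) (hne : ∀ x ∈ X, ∃ y, (x, y) ∈ Γ)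
    (hconv : ∀ x ∈ X, Convex ℝ {y | (x, y) ∈ Γ}) : ∃ x, (x, x) ∈ Γ := by
  by_contra! hno
  have hΓc : IsCompact Γ := (hXc.prod hXc).of_isClosed_subset hΓ hsub
  -- Near `x`, the points and the values lie in disjoint sets `A x` and `B x`, the latter convex.
  have hsep : ∀ x ∈ X, ∃ A B : Set E, A ∈ 𝓝 x ∧ Convex ℝ B ∧ Disjoint A B ∧
      ∀ a ∈ A, ∀ y, (a, y) ∈ Γ → y ∈ B := by
    intro x hx
    obtain ⟨A, B, hA, hB, -, hBc, hxA, hxB, hAB⟩ := exists_open_convex_of_notMem (𝕜 := ℝ)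
      (show x ∉ {y | (x, y) ∈ Γ} from hno x) (hconv x hx) (hΓ.preimage (by fun_prop))
    have hcl : IsClosed (Prod.fst '' (Γ ∩ Prod.snd ⁻¹' Bᶜ)) :=
      ((hΓc.inter_right (hB.isClosed_compl.preimage continuous_snd)).image
        continuous_fst).isClosed
    refine ⟨A ∩ (Prod.fst '' (Γ ∩ Prod.snd ⁻¹' Bᶜ))ᶜ, B, ?_, hBc,
      hAB.mono_left Set.inter_subset_left, fun a ha y hy => ?_⟩
    · refine Filter.inter_mem (hA.mem_nhds hxA) (hcl.isOpen_compl.mem_nhds ?_)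
      rintro ⟨⟨x', y⟩, ⟨hy, hyB⟩, rfl⟩
      exact hyB (hxB hy)
    · by_contra hyB
      exact ha.2 ⟨(a, y), ⟨hy, hyB⟩, rfl⟩
  choose! A B hA hBc hAB hABΓ using hsep
  let : UniformSpace E := IsTopologicalAddGroup.rightUniformSpace E
  have : IsUniformAddGroup E := isUniformAddGroup_of_addCommGroup
  obtain ⟨V, hV, hVA⟩ := lebesgue_number_lemma_nhds' (U := fun x _ => A x) hXc hA
  rw [uniformity_eq_comap_nhds_zero, Filter.mem_comap] at hV
  obtain ⟨W, hW, hWV⟩ := hV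
  obtain ⟨x, hx, hxconv⟩ := exists_mem_convexHull_of_mem_nhds hXne hXc hXconv hsub hne
    (U := -W) (neg_mem_nhds_zero E hW)
  obtain ⟨⟨z, hz⟩, hzA⟩ := hVA x hx
  have hWA : ∀ a, a - x ∈ W → a ∈ A z := fun a ha => hzA (hWV ha)
  have hxA : x ∈ A z := hWA x (by simpa using mem_of_mem_nhds hW)
  refine Set.disjoint_left.1 (hAB z hz) hxA (convexHull_min ?_ (hBc z hz) hxconv)
  rintro y ⟨a, -, ha, hay⟩
  exact hABΓ z hz a (hWA a (by simpa using ha)) y hay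

end KakutaniFanGlicksberg

/-! ### Continuous selections on simplices -/

theorem IsSimplex.isCompact {E : Type*} [AddCommGroup E] [Module ℝ E] [TopologicalSpace E]
    [IsTopologicalAddGroup E] [ContinuousSMul ℝ E] {m : ℕ} {K : Set E} (hK : IsSimplex m K) :
    IsCompact K := by
  obtain ⟨s, rfl⟩ := hK
  exact (Set.finite_range _).isCompact_convexHull (𝕜 := ℝ)

/-- A weakly naturally quasi-concave correspondence on a simplex has a continuous selection: in
barycentric coordinates, `l ↦ ∑ gₖ(lₖ) yₖ` for the data `yₖ`, `gₖ` attached to the vertices. -/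
theorem WeaklyNaturallyQuasiConcave.exists_continuous_selection {E F : Type*}
    [AddCommGroup E] [Module ℝ E] [TopologicalSpace E] [IsTopologicalAddGroup E]
    [ContinuousSMul ℝ E] [T2Space E]
    [AddCommGroup F] [Module ℝ F] [TopologicalSpace F] [IsTopologicalAddGroup F]
    [ContinuousSMul ℝ F] {m : ℕ} {K : Set E} (hK : IsSimplex m K) {Y : Set F} {T : K → Set Y}
    (hT : WeaklyNaturallyQuasiConcave T) : ∃ f : K → Y, Continuous f ∧ ∀ x, f x ∈ T x := by
  obtain ⟨s, rfl⟩ := hK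
  let v : Fin (m + 1) → convexHull ℝ (Set.range s.points) := fun k =>
    ⟨s.points k, subset_convexHull ℝ _ ⟨k, rfl⟩⟩
  obtain ⟨y, -, g, hg, hgT⟩ := hT (m + 1) v fun i j h =>
    s.independent.injective (congrArg Subtype.val h)
  choose hgs z w hz hw hwT using hgT
  -- `φ` passes from barycentric coordinates to points; it is a homeomorphism.
  let φ : stdSimplex ℝ (Fin (m + 1)) → convexHull ℝ (Set.range s.points) := fun l => z l.1 l.2
  have hφ : ∀ l, (φ l : E) = ∑ k, l.1 k • s.points k := fun l => hz l.1 l.2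
  have hφc : Continuous φ := by
    refine continuous_induced_rng.2 ?_
    have : (Subtype.val ∘ φ) = fun l => ∑ k, l.1 k • s.points k := funext hφ
    rw [this]
    exact continuous_finsetSum _ fun k _ =>
      ((continuous_apply k).comp continuous_subtype_val).smul continuous_const
  have hφi : Function.Injective φ := by
    intro l l' h
    have h1 : ∑ k, l.1 k • s.points k = ∑ k, l'.1 k • s.points k := by rw [← hφ, ← hφ, h]
    have h2 := affineIndependent_iff.1 s.independent Finset.univ (fun k => l.1 k - l'.1 k)
      (by rw [Finset.sum_sub_distrib, l.2.2, l'.2.2, sub_self])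
      (by simp only [sub_smul, Finset.sum_sub_distrib, h1, sub_self])
    exact Subtype.ext (funext fun k => sub_eq_zero.1 (h2 k (Finset.mem_univ k)))
  have hφs : Function.Surjective φ := by
    rintro ⟨x, hx⟩
    let L : (Fin (m + 1) → ℝ) →ₗ[ℝ] E := Fintype.linearCombination ℝ s.points
    have hsub : convexHull ℝ (Set.range s.points) ⊆ L '' stdSimplex ℝ (Fin (m + 1)) := by
      refine convexHull_min ?_ ((convex_stdSimplex ℝ _).linear_image L)
      rintro _ ⟨k, rfl⟩
      exact ⟨_, single_mem_stdSimplex ℝ k, by simp [L, Fintype.linearCombination_apply_single]⟩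
    obtain ⟨l, hl, rfl⟩ := hsub hx
    exact ⟨⟨l, hl⟩, Subtype.ext (by rw [hφ]; simp [L, Fintype.linearCombination_apply])⟩
  have : CompactSpace (stdSimplex ℝ (Fin (m + 1))) :=
    isCompact_iff_compactSpace.1 (isCompact_stdSimplex (𝕜 := ℝ) _)
  let e := (Equiv.ofBijective φ ⟨hφi, hφs⟩)
  let h := Continuous.homeoOfEquivCompactToT2 (f := e) hφc
  have hwc : Continuous fun l : stdSimplex ℝ (Fin (m + 1)) => w l.1 l.2 := by
    refine continuous_induced_rng.2 ?_
    have : (Subtype.val ∘ fun l : stdSimplex ℝ (Fin (m + 1)) => w l.1 l.2) =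
        fun l => ∑ k, g k (l.1 k) • (y k : F) := funext fun l => hw l.1 l.2
    rw [this]
    refine continuous_finsetSum _ fun k _ => Continuous.smul ?_ continuous_const
    exact (hg k).1.comp_continuous ((continuous_apply k).comp continuous_subtype_val)
      fun l => mem_Icc_of_mem_stdSimplex l.2 k
  refine ⟨fun x => w (h.symm x).1 (h.symm x).2, hwc.comp h.symm.continuous, fun x => ?_⟩
  have hx : z (h.symm x).1 (h.symm x).2 = x := h.apply_symm_apply x
  have := hwT (h.symm x).1 (h.symm x).2
  rwa [hx] at this

/-! ### Thickened graphs -/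

/-- An upper hemicontinuous correspondence with closed values in a regular space has a closed
graph. -/
theorem UpperHemicontinuous.isClosed_graph {S Y : Type*} [TopologicalSpace S] [TopologicalSpace Y]
    [RegularSpace Y] {Φ : S → Set Y} (hΦ : UpperHemicontinuous Φ) (hcl : ∀ x, IsClosed (Φ x)) :
    IsClosed {p : S × Y | p.2 ∈ Φ p.1} := by
  refine isClosed_of_closure_subset fun p hp => ?_
  exact (upperHemicontinuous_iff.1 hΦ p.1).mem_of_tendsto (hcl p.1) (l := 𝓝 p)
    continuous_fst.continuousAt (mem_closure_iff_frequently.1 hp) continuous_snd.continuousAt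

/-- The graph of the correspondence `x ↦ (Φ x + V) ∩ Y`, for a correspondence `Φ` with values in
subsets of `Y`. -/
def thickenedGraph {S F : Type*} [AddCommGroup F] {Y : Set F} (Φ : S → Set Y) (V : Set F) :
    Set (S × Y) :=
  {p | ∃ b ∈ Φ p.1, (p.2 : F) - b ∈ V}

section Thickened

variable {S F : Type*} [AddCommGroup F] {Y : Set F} {Φ : S → Set Y} {V : Set F}

theorem isClosed_thickenedGraph [TopologicalSpace S] [TopologicalSpace F] [IsTopologicalAddGroup F]
    (hY : IsCompact Y) (hΦ : UpperHemicontinuous Φ)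
    (hcl : ∀ x, IsClosed (Φ x)) (hV : IsClosed V) : IsClosed (thickenedGraph Φ V) := by
  have : CompactSpace Y := isCompact_iff_compactSpace.1 hY
  have h1 : IsClosed {q : (S × Y) × Y | q.2 ∈ Φ q.1.1} :=
    (hΦ.isClosed_graph hcl).preimage (f := fun q : (S × Y) × Y => (q.1.1, q.2)) (by fun_prop)
  have h2 : IsClosed {q : (S × Y) × Y | (q.1.2 : F) - q.2 ∈ V} :=
    hV.preimage (f := fun q : (S × Y) × Y => (q.1.2 : F) - q.2) (by fun_prop)
  convert isClosedMap_fst_of_compactSpace _ (h1.inter h2) using 1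
  ext p
  constructor
  · rintro ⟨b, hb, hbV⟩
    exact ⟨(p, b), ⟨hb, hbV⟩, rfl⟩
  · rintro ⟨⟨p, b⟩, ⟨hb, hbV⟩, rfl⟩
    exact ⟨b, hb, hbV⟩

theorem convex_section_thickenedGraph [Module ℝ F] (hY : Convex ℝ Y) {x : S}
    (hΦ : Convex ℝ ((↑) '' Φ x : Set F)) (hV : Convex ℝ V) :
    Convex ℝ ((↑) '' {y | (x, y) ∈ thickenedGraph Φ V} : Set F) := by
  convert hY.inter (hΦ.add hV) using 1
  ext y
  constructor
  · rintro ⟨y, ⟨b, hb, hbV⟩, rfl⟩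
    exact ⟨y.2, b, ⟨b, hb, rfl⟩, _, hbV, by simp⟩
  · rintro ⟨hy, _, ⟨b, hb, rfl⟩, u, hu, rfl⟩
    exact ⟨⟨_, hy⟩, ⟨b, hb, by simpa using hu⟩, rfl⟩

end Thickened

/-- A locally convex space has arbitrarily small closed convex neighbourhoods of `0`. -/
theorem exists_isClosed_convex_subset_of_mem_nhds_zero {F : Type*} [AddCommGroup F] [Module ℝ F]
    [TopologicalSpace F] [IsTopologicalAddGroup F] [ContinuousSMul ℝ F] [LocallyConvexSpace ℝ F]
    {U : Set F} (hU : U ∈ 𝓝 0) : ∃ V ∈ 𝓝 (0 : F), IsClosed V ∧ Convex ℝ V ∧ V ⊆ U := by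
  obtain ⟨C, hC, hCcl, hCU⟩ := exists_mem_nhds_isClosed_subset hU
  obtain ⟨V, ⟨hV, hVc⟩, hVC⟩ := (LocallyConvexSpace.convex_basis_zero ℝ F).mem_iff.1 hC
  exact ⟨closure V, Filter.mem_of_superset hV subset_closure, isClosed_closure, hVc.closure,
    (closure_minimal hVC hCcl).trans hCU⟩

/-- If `y` lies in `Φ x + V` for all closed convex neighbourhoods `V` of `0`, then `y` lies in the
closure of `Φ x`. -/
theorem mem_closure_of_forall_mem_thickenedGraph {S F : Type*} [AddCommGroup F] [Module ℝ F]
    [TopologicalSpace F] [IsTopologicalAddGroup F] [ContinuousSMul ℝ F] [LocallyConvexSpace ℝ F]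
    {Y : Set F} {Φ : S → Set Y} {x : S} {y : Y}
    (h : ∀ V ∈ 𝓝 (0 : F), IsClosed V → Convex ℝ V → (x, y) ∈ thickenedGraph Φ V) :
    y ∈ closure (Φ x) := by
  rw [mem_closure_iff_nhds]
  intro N hN
  obtain ⟨N', hN', hNN'⟩ := mem_nhds_subtype _ _ _ |>.1 hN
  have hU : (fun v : F => (y : F) - v) ⁻¹' N' ∈ 𝓝 (0 : F) := by
    refine ContinuousAt.preimage_mem_nhds (by fun_prop) ?_
    simpa using hN'
  obtain ⟨V, hV, hVcl, hVc, hVU⟩ := exists_isClosed_convex_subset_of_mem_nhds_zero hU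
  obtain ⟨b, hb, hbV⟩ := h V hV hVcl hVc
  exact ⟨b, hNN' (by simpa using hVU hbV), hb⟩

/-! ### Equilibria -/

namespace AbstractEconomy

variable {I : Type*} {E : I → Type*} [∀ i, TopologicalSpace (E i)]

theorem continuous_coord (G : AbstractEconomy I E) (i : I) : Continuous (G.coord i) :=
  Continuous.subtype_mk ((continuous_apply i).comp continuous_subtype_val) _

/-- If `xᵢ ∈ (cl Bᵢ)(x)`, then `xᵢ ∈ B̄ᵢ(x)`. -/
theorem mem_graphAdherence_of_mem_clB {G : AbstractEconomy I E} {i : I} {x : Set.univ.pi G.X}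
    {y : G.X i} (hy : y ∈ G.clB i x) : y ∈ graphAdherence (G.B i) x :=
  map_mem_closure (f := fun y : G.X i => (x, y)) (by fun_prop) hy fun _ h => h

variable [∀ i, AddCommGroup (E i)] [∀ i, Module ℝ (E i)]
    [∀ i, IsTopologicalAddGroup (E i)] [∀ i, ContinuousSMul ℝ (E i)]
    [∀ i, T2Space (E i)]

/-- The correspondence to which the fixed point theorem is applied for agent `i`: it is
`(cl Bᵢ + V) ∩ Xᵢ` off `Wᵢ` and a continuous selection of a weakly naturally quasi-concave
correspondence on `Wᵢ`. The selection stays away from `xᵢ`, so that fixed points lie off `Wᵢ`. -/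
theorem exists_isClosed_graph (G : AbstractEconomy I E) {i : I}
    (hXcpt : IsCompact (G.X i)) (hXconv : Convex ℝ (G.X i))
    (hBusc : UpperHemicontinuous (G.clB i)) (hBne : ∀ x, (G.clB i x).Nonempty)
    (hBconv : ∀ x, Convex ℝ ((↑) '' G.clB i x : Set (E i))) (hWopen : IsOpen (G.W i))
    {m : ℕ} {K : Set (∀ j, E j)} (hKX : K ⊆ Set.univ.pi G.X) (hK : IsSimplex m K)
    (hWK : G.W i ⊆ ((↑) ⁻¹' K : Set (Set.univ.pi G.X))) (hEW : G.EWNQS i (G.clB i) K hKX)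
    {V : Set (E i)} (hV : V ∈ 𝓝 0) (hVcl : IsClosed V) (hVc : Convex ℝ V) :
    ∃ Γ : Set (Set.univ.pi G.X × G.X i), IsClosed Γ ∧ (∀ x, ∃ y, (x, y) ∈ Γ) ∧
      (∀ x, Convex ℝ ((↑) '' {y | (x, y) ∈ Γ} : Set (E i))) ∧
      ∀ x, (x, G.coord i x) ∈ Γ → x ∉ G.W i ∧ (x, G.coord i x) ∈ thickenedGraph (G.clB i) V := by
  obtain ⟨T, hT, hTx⟩ := hEW V hVc hV
  obtain ⟨f, hf, hfT⟩ := hT.exists_continuous_selection hK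
  have : CompactSpace K := isCompact_iff_compactSpace.1 hK.isCompact
  let Γ₁ : Set (Set.univ.pi G.X × G.X i) := Set.range fun k : K => (⟨k.1, hKX k.2⟩, f k)
  let Γ₂ := thickenedGraph (G.clB i) V ∩ Prod.fst ⁻¹' (G.W i)ᶜ
  have hΓ₁ : IsClosed Γ₁ := (isCompact_range (by fun_prop)).isClosed
  have hΓ₂ : IsClosed Γ₂ :=
    (isClosed_thickenedGraph hXcpt hBusc (fun _ => isClosed_closure) hVcl).inter
      (hWopen.isClosed_compl.preimage continuous_fst)
  -- On `K` the selection lies in the thickening, so that the union has the sections wanted.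
  have hΓ₁V : Γ₁ ⊆ thickenedGraph (G.clB i) V := by
    rintro _ ⟨k, rfl⟩
    obtain ⟨b, hb, v, hv, hbv⟩ := (hTx k).2 _ (hfT k)
    exact ⟨b, hb, by simpa [hbv] using hv⟩
  have hsecW : ∀ x (hx : x ∈ G.W i), {y | (x, y) ∈ Γ₁ ∪ Γ₂} = {f ⟨x, hWK hx⟩} := by
    intro x hx
    ext y
    constructor
    · rintro (⟨k, hk⟩ | ⟨-, h⟩)
      · obtain ⟨rfl, rfl⟩ := Prod.mk.inj hk
        rfl
      · exact absurd hx h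
    · rintro rfl
      exact Or.inl ⟨⟨x, hWK hx⟩, rfl⟩
  have hsec : ∀ x, x ∉ G.W i →
      {y | (x, y) ∈ Γ₁ ∪ Γ₂} = {y | (x, y) ∈ thickenedGraph (G.clB i) V} := by
    intro x hx
    ext y
    exact ⟨fun h => h.elim (fun h => hΓ₁V h) And.left, fun h => Or.inr ⟨h, hx⟩⟩
  refine ⟨Γ₁ ∪ Γ₂, hΓ₁.union hΓ₂, fun x => ?_, fun x => ?_, fun x hx => ?_⟩
  · by_cases hx : x ∈ G.W i
    · exact ⟨f ⟨x, hWK hx⟩, Or.inl ⟨⟨x, hWK hx⟩, rfl⟩⟩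
    · obtain ⟨b, hb⟩ := hBne x
      exact ⟨b, Or.inr ⟨⟨b, hb, by simpa using mem_of_mem_nhds hV⟩, hx⟩⟩
  · by_cases hx : x ∈ G.W i
    · rw [hsecW x hx, Set.image_singleton]
      exact convex_singleton _
    · rw [hsec x hx]
      exact convex_section_thickenedGraph hXconv (hBconv x) hVc
  · rcases hx with ⟨k, hk⟩ | ⟨h, hxW⟩
    · obtain ⟨rfl, hfk⟩ := Prod.mk.inj hk
      exact absurd (hfk ▸ hfT k) (hTx k).1
    · exact ⟨hxW, h⟩

/-- The fixed point theorem for a product of correspondences with closed graphs. -/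
theorem exists_forall_coord_mem [∀ i, LocallyConvexSpace ℝ (E i)] (G : AbstractEconomy I E)
    (hXne : ∀ i, (G.X i).Nonempty) (hXcpt : ∀ i, IsCompact (G.X i))
    (hXconv : ∀ i, Convex ℝ (G.X i)) (Γ : ∀ i, Set (Set.univ.pi G.X × G.X i))
    (hΓ : ∀ i, IsClosed (Γ i)) (hne : ∀ i x, ∃ y, (x, y) ∈ Γ i)
    (hconv : ∀ i x, Convex ℝ ((↑) '' {y | (x, y) ∈ Γ i} : Set (E i))) :
    ∃ x, ∀ i, (x, G.coord i x) ∈ Γ i := by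
  have hXc : IsCompact (Set.univ.pi G.X) := isCompact_univ_pi hXcpt
  have : CompactSpace (Set.univ.pi G.X) := isCompact_iff_compactSpace.1 hXc
  let Δ : Set (Set.univ.pi G.X × Set.univ.pi G.X) := {p | ∀ i, (p.1, G.coord i p.2) ∈ Γ i}
  have hΔ : IsClosed Δ := by
    simp only [Δ, Set.ofPred_forall]
    exact isClosed_iInter fun i => (hΓ i).preimage
      (continuous_fst.prodMk ((G.continuous_coord i).comp continuous_snd))
  have hsec : ∀ x : Set.univ.pi G.X, {y | ((x : ∀ i, E i), y) ∈ Prod.map (↑) (↑) '' Δ} =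
      Set.univ.pi fun i => ((↑) '' {y | (x, y) ∈ Γ i} : Set (E i)) := by
    intro x
    ext y
    constructor
    · rintro ⟨⟨x', y⟩, hxy, hp⟩ i -
      obtain ⟨hx', rfl⟩ := Prod.mk.inj hp
      obtain rfl := Subtype.ext hx'
      exact ⟨_, hxy i, rfl⟩
    · intro hy
      choose u hu huy using fun i => hy i (Set.mem_univ i)
      refine ⟨(x, ⟨y, fun i _ => huy i ▸ (u i).2⟩), fun i => ?_, rfl⟩
      have : G.coord i ⟨y, fun i _ => huy i ▸ (u i).2⟩ = u i := Subtype.ext (huy i).symm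
      exact this.symm ▸ hu i
  obtain ⟨x, ⟨⟨x', x''⟩, h, hp⟩⟩ := exists_diag_mem_of_isClosed_graph (X := Set.univ.pi G.X)
    (Γ := Prod.map (↑) (↑) '' Δ) (Set.univ_pi_nonempty_iff.2 hXne) hXc
    (convex_pi fun i _ => hXconv i)
    (hΔ.isCompact.image (by fun_prop)).isClosed
    (by rintro _ ⟨p, -, rfl⟩; exact ⟨p.1.2, p.2.2⟩)
    (fun x hx => by
      choose y hy using fun i => hne i ⟨x, hx⟩
      have : (fun i => (y i : E i)) ∈ Set.univ.pi fun i =>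
          ((↑) '' {y | (⟨x, hx⟩, y) ∈ Γ i} : Set (E i)) := fun i _ => ⟨y i, hy i, rfl⟩
      rw [← hsec ⟨x, hx⟩] at this
      exact ⟨_, this⟩)
    (fun x hx => by
      rw [hsec ⟨x, hx⟩]
      exact convex_pi fun i _ => hconv i _)
  obtain ⟨rfl, hx⟩ := Prod.mk.inj hp
  obtain rfl := Subtype.ext hx
  exact ⟨_, h⟩

end AbstractEconomy

theorem theorem15 {I : Type*} {E : I → Type*}
    [∀ i, AddCommGroup (E i)] [∀ i, Module ℝ (E i)] [∀ i, TopologicalSpace (E i)]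
    [∀ i, IsTopologicalAddGroup (E i)] [∀ i, ContinuousSMul ℝ (E i)]
    [∀ i, LocallyConvexSpace ℝ (E i)] [∀ i, T2Space (E i)]
    (G : AbstractEconomy I E)
    (hXne : ∀ i, (G.X i).Nonempty)
    (hXcpt : ∀ i, IsCompact (G.X i))
    (hXconv : ∀ i, Convex ℝ (G.X i))
    (hBusc : ∀ i, UpperHemicontinuous (G.clB i))
    (hBne : ∀ i x, (G.clB i x).Nonempty)
    (hBconv : ∀ i x, Convex ℝ ((↑) '' G.clB i x : Set (E i)))
    (hWopen : ∀ i, IsOpen (G.W i))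
    (hK : ∀ i, ∃ (m : ℕ) (K : Set (∀ j, E j)) (hKX : K ⊆ Set.univ.pi G.X),
      IsSimplex m K ∧
      G.W i ⊆ interior ((↑) ⁻¹' K : Set (Set.univ.pi G.X)) ∧
      G.EWNQS i (G.clB i) K hKX) :
    ∃ x : Set.univ.pi G.X, G.IsEquilibrium x := by
  have : CompactSpace (Set.univ.pi G.X) := isCompact_iff_compactSpace.1 (isCompact_univ_pi hXcpt)
  choose m K hKX hKs hWK hEW using hK
  -- `Q V` is the set of `V`-approximate equilibria; these sets are compact, nonempty and directed.
  let N : I → Type _ := fun i => {V : Set (E i) // V ∈ 𝓝 0 ∧ IsClosed V ∧ Convex ℝ V}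
  let Q : (∀ i, N i) → Set (Set.univ.pi G.X) := fun V =>
    {x | ∀ i, x ∉ G.W i ∧ (x, G.coord i x) ∈ thickenedGraph (G.clB i) (V i).1}
  have hQne : ∀ V, (Q V).Nonempty := by
    intro V
    choose Γ hΓ hne hconv hdiag using fun i => G.exists_isClosed_graph (hXcpt i) (hXconv i)
      (hBusc i) (hBne i) (hBconv i) (hWopen i) (hKX i) (hKs i)
      ((hWK i).trans interior_subset) (hEW i) (V i).2.1 (V i).2.2.1 (V i).2.2.2
    obtain ⟨x, hx⟩ := G.exists_forall_coord_mem hXne hXcpt hXconv Γ hΓ hne hconv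
    exact ⟨x, fun i => hdiag i x (hx i)⟩
  have hQcl : ∀ V, IsClosed (Q V) := by
    intro V
    simp only [Q, Set.ofPred_forall, Set.ofPred_and]
    exact isClosed_iInter fun i => (hWopen i).isClosed_compl.inter
      ((isClosed_thickenedGraph (hXcpt i) (hBusc i) (fun _ => isClosed_closure)
        (V i).2.2.1).preimage (continuous_id.prodMk (G.continuous_coord i)))
  have hQdir : Directed (· ⊇ ·) Q := by
    intro V V'
    refine ⟨fun i => ⟨(V i).1 ∩ (V' i).1, Filter.inter_mem (V i).2.1 (V' i).2.1,
      (V i).2.2.1.inter (V' i).2.2.1, (V i).2.2.2.inter (V' i).2.2.2⟩, ?_, ?_⟩ <;>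
    · intro x hx i
      obtain ⟨h, b, hb, hbV⟩ := hx i
      first
        | exact ⟨h, b, hb, hbV.1⟩
        | exact ⟨h, b, hb, hbV.2⟩
  have : Nonempty (∀ i, N i) := ⟨fun i => ⟨Set.univ, Filter.univ_mem, isClosed_univ, convex_univ⟩⟩
  obtain ⟨x, hx⟩ := IsCompact.nonempty_iInter_of_directed_nonempty_isCompact_isClosed Q hQdir hQne
    (fun V => (hQcl V).isCompact) hQcl
  have hxQ : ∀ V, x ∈ Q V := Set.mem_iInter.1 hx
  refine ⟨x, fun i => ⟨AbstractEconomy.mem_graphAdherence_of_mem_clB ?_, ?_⟩⟩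
  · have := mem_closure_of_forall_mem_thickenedGraph (Φ := G.clB i) (x := x) (y := G.coord i x)
      fun V hV hVcl hVc => by
        classical
        let V' : ∀ j, N j := Function.update
          (fun i => ⟨Set.univ, Filter.univ_mem, isClosed_univ, convex_univ⟩) i ⟨V, hV, hVcl, hVc⟩
        have h := (hxQ V' i).2
        simpa only [V', Function.update_self] using h
    exact closure_closure.subset this
  · let V₀ : ∀ j, N j := fun i => ⟨Set.univ, Filter.univ_mem, isClosed_univ, convex_univ⟩
    exact Set.not_nonempty_iff_eq_empty.1 (hxQ V₀ i).1
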